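/- Let $r\ge 1$, let $n_1,\dots,n_r\ge 0$ be integers with sum $n$, and let $W=\mathcal S_{n_1}\times\cdots\times\mathcal S_{n_r}\subset\mathcal S_n$ be the subgroup preserving each block $B_i=\{n_1+\cdots+n_{i-1}+1,\dots,n_1+\cdots+n_i\}$. The group $\mathcal S_n$ acts on $\mathbb C[x_1,\dots,x_n]$ by $(\sigma f)(x_1,\dots,x_n)=f(x_{\sigma(1)},\dots,x_{\sigma(n)})$. Write $\mathbb C[x_1,\dots,x_n]^{W}=\mathbb C[y_1,\dots,y_n]$, and put $\Delta=\prod_{i=1}^r\prod_{j<k,\ j,k\in B_i}(x_j-x_k)$ and $\mathcal O_U=\mathbb C[x_1,\dots,x_n,\Delta^{-1}]$, with the induced action of $W$. Let $\mathcal D_V=\mathbb C\langle y_1,\dots,y_n,\partial/\partial y_1,\dots,\partial/\partial y_n,\Delta^{-2}\rangle$, acting on $\mathcal O_U$; here $\partial/\partial y_j$ acts as the unique derivation of $\mathcal O_U$ with $\partial y_k/\partial y_j=\delta_{jk}$. Let $\lambda=(\lambda^1,\dots,\lambda^r)$ be an $r$-tuple of Young diagrams with $|\lambda^i|=n_i$.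 A standard $r$-tableau $T=(T^1,\dots,T^r)$ of shape $\lambda$ is a filling of the boxes by $1,\dots,n$, each used once, such that rows and columns of every $T^i$ are strictly increasing; it is natural if $T^i$ is filled with $B_i$ for every $i$. Let $R(T^i)$ and $C(T^i)$ be the row and column stabilizers of $T^i$, let $f^{\lambda^i}$ be the number of standard tableaux of shape $\lambda^i$, and let $$e_{T^i}=\frac{f^{\lambda^i}}{n_i!}\sum_{\sigma\in R(T^i),\,\tau\in C(T^i)}\operatorname{sgn}(\tau)\,\tau\sigma,\qquad e_T=e_{T^1}\cdots e_{T^r}.$$ The word of a tableau is obtained by reading the components in order, in each component the columns from left to right, and each column from bottom to top. The index of $1$ is $0$; if $k$ has index $p$, then $k+1$ has index $p+1$ if it lies to the left of $k$ in the word, and index $p$ if it lies to the right. Let $i(S)$ be the tableau of the indices of the entries of $S$. For $T,S$ of shape $\lambda$, let $x_T^{i(S)}$ be the product over all boxes $c$ of $x_{T(c)}^{i(S)(c)}$, and let $F_T^S=e_T(x_T^{i(S)})$ be the higher Specht polynomial. For a single component and a tableau $s$ of shape $\lambda^i$ with entries $1,\dots,n_i$ put likewise $F_{T^i}^{s}=e_{T^i}(x_{T^i}^{i(s)})$,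 and let $$F_T=F_{T^1}^{S_0^1}\cdots F_{T^r}^{S_0^r},$$ where $S_0^i$ is the tableau of shape $\lambda^i$ whose boxes are numbered $1,\dots,n_i$ from left to right in successive rows, starting from the top. **Proposition 3.16.** Let $T$ be a natural standard $r$-tableau of shape $\lambda$, $S$ a standard $r$-tableau of shape $\lambda$, and $\mathbf D\in\mathcal D_V$ a derivation with $\mathbf D(F_T^S)\ne 0$. Then there is $G\in\mathcal O_U$, invariant under $C(T)=C(T^1)\times\cdots\times C(T^r)$, such that $\mathbf D(F_T^S)=F_T\,G$. -/

import Mathlib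

open MvPolynomial
open scoped Pointwise

/-! Variables are `x_k`, `k : Fin (∑ i, n i)`; numbers `1, …, n` of the text are shifted to
`0, …, n - 1`. -/

namespace HigherSpecht

/-- The boxes of an `r`-tuple of Young diagrams: a component and a box `(row, column)` in it. -/
abbrev Cell {r : ℕ} (lam : Fin r → YoungDiagram) : Type :=
  Σ i : Fin r, {c : ℕ × ℕ // c ∈ (lam i).cells}

/-- The row of a box inside its component. -/
def Cell.row {r : ℕ} {lam : Fin r → YoungDiagram} (c : Cell lam) : ℕ := c.2.1.1

/-- The column of a box inside its component. -/
def Cell.col {r : ℕ} {lam : Fin r → YoungDiagram} (c : Cell lam) : ℕ := c.2.1.2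

/-- Standard `r`-tableaux with entries `0, …, N - 1`: each number appears exactly once, and each
row and each column of each component is strictly increasing. -/
structure IsStandard {r N : ℕ} {lam : Fin r → YoungDiagram} (T : Cell lam → Fin N) : Prop where
  bijective : Function.Bijective T
  row_lt : ∀ a b : Cell lam, a.1 = b.1 → a.row = b.row → a.col < b.col → T a < T b
  col_lt : ∀ a b : Cell lam, a.1 = b.1 → a.col = b.col → a.row < b.row → T a < T b

/-- The `i`-th block of numbers, `n_1 + ⋯ + n_{i-1} ≤ k < n_1 + ⋯ + n_i`. -/
def block {r : ℕ} (n : Fin r → ℕ) (i : Fin r) : Set (Fin (∑ i, n i)) :=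
  {k | ∑ j ∈ Finset.Iio i, n j ≤ (k : ℕ) ∧ (k : ℕ) < ∑ j ∈ Finset.Iic i, n j}

/-- The set of entries of the `i`-th component of a tableau. -/
def entries {r N : ℕ} {lam : Fin r → YoungDiagram} (T : Cell lam → Fin N) (i : Fin r) :
    Set (Fin N) :=
  {k | ∃ c : Cell lam, c.1 = i ∧ T c = k}

/-- Natural standard `r`-tableaux: the `i`-th component is filled with the `i`-th block. -/
structure IsNatural {r : ℕ} (n : Fin r → ℕ) {lam : Fin r → YoungDiagram}
    (T : Cell lam → Fin (∑ i, n i)) : Prop where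
  standard : IsStandard T
  natural : ∀ i, entries T i = block n i

/-- `a` is read strictly before (to the left of) `b` in the word of a tableau: components from the
first to the last, in each component the columns from left to right, each column from the bottom
to the top. -/
def ReadBefore {r : ℕ} {lam : Fin r → YoungDiagram} (a b : Cell lam) : Prop :=
  a.1 < b.1 ∨ (a.1 = b.1 ∧ (a.col < b.col ∨ (a.col = b.col ∧ b.row < a.row)))

open Classical in
/-- The index of the number `k` in the word of the filling `t`: the smallest number has index `0`,
and if `k` has index `p`, then `k + 1` has index `p + 1` if it lies to the left of `k`, and `p`
otherwise. -/
noncomputable def wordIndex {r : ℕ} {lam : Fin r → YoungDiagram} (t : Cell lam → ℕ) : ℕ → ℕ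
  | 0 => 0
  | k + 1 =>
    if ∃ a b : Cell lam, t a = k + 1 ∧ t b = k ∧ ReadBefore a b then wordIndex t k + 1
    else wordIndex t k

/-- The index tableau `i(t)` of the filling `t`. -/
noncomputable def indexTableau {r : ℕ} {lam : Fin r → YoungDiagram} (t : Cell lam → ℕ)
    (c : Cell lam) : ℕ :=
  wordIndex t (t c)

/-- The canonical tableau of shape `mu` (as a one-component tableau): the boxes are numbered from
left to right in successive rows, starting from the top. -/
def canonicalTableau (mu : YoungDiagram) (c : Cell (fun _ : Fin 1 => mu)) : ℕ :=
  (∑ a ∈ Finset.range c.row, mu.rowLen a) + c.col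

/-- The number `f^mu` of standard tableaux of shape `mu`. -/
noncomputable def numStandard (mu : YoungDiagram) : ℕ :=
  Nat.card {t : Cell (fun _ : Fin 1 => mu) → Fin mu.card // IsStandard t}

/-- The row stabilizer `R(T^i)`: permutations that move only entries of the `i`-th component and
preserve each of its rows. -/
def rowStab {r N : ℕ} {lam : Fin r → YoungDiagram} (T : Cell lam → Fin N) (i : Fin r) :
    Subgroup (Equiv.Perm (Fin N)) :=
  fixingSubgroup (Equiv.Perm (Fin N)) (entries T i)ᶜ ⊓
    ⨅ a : ℕ, MulAction.stabilizer (Equiv.Perm (Fin N))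
      {k : Fin N | ∃ c : Cell lam, c.1 = i ∧ c.row = a ∧ T c = k}

/-- The column stabilizer `C(T^i)`: permutations that move only entries of the `i`-th component
and preserve each of its columns. -/
def colStab {r N : ℕ} {lam : Fin r → YoungDiagram} (T : Cell lam → Fin N) (i : Fin r) :
    Subgroup (Equiv.Perm (Fin N)) :=
  fixingSubgroup (Equiv.Perm (Fin N)) (entries T i)ᶜ ⊓
    ⨅ b : ℕ, MulAction.stabilizer (Equiv.Perm (Fin N))
      {k : Fin N | ∃ c : Cell lam, c.1 = i ∧ c.col = b ∧ T c = k}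

/-- The column stabilizer `C(T) = C(T^1) × ⋯ × C(T^r)`, as an internal product in the symmetric
group (the factors move disjoint sets of numbers). -/
def colStabilizer {r N : ℕ} {lam : Fin r → YoungDiagram} (T : Cell lam → Fin N) :
    Subgroup (Equiv.Perm (Fin N)) :=
  ⨆ i, colStab T i

/-- The action of the group algebra of the symmetric group on polynomials,
`(σ f)(x_1, …, x_N) = f(x_{σ(1)}, …, x_{σ(N)})`. -/
noncomputable def groupAlgebraAct (N : ℕ) :
    MonoidAlgebra ℂ (Equiv.Perm (Fin N)) →ₐ[ℂ] Module.End ℂ (MvPolynomial (Fin N) ℂ) :=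
  MonoidAlgebra.lift ℂ (Module.End ℂ (MvPolynomial (Fin N) ℂ)) (Equiv.Perm (Fin N))
    { toFun := fun σ => (rename σ : MvPolynomial (Fin N) ℂ →ₐ[ℂ] _).toLinearMap
      map_one' := by
        ext1 m
        ext1
        simp
      map_mul' := fun σ τ => by
        ext1 m
        ext1
        simp }

open Classical in
/-- The Young symmetrizer `e_{T^i} = (f^{λ^i} / n_i!) ∑_{σ ∈ R(T^i), τ ∈ C(T^i)} sgn(τ) τ σ`. -/
noncomputable def youngSymmetrizer {r N : ℕ} {lam : Fin r → YoungDiagram} (T : Cell lam → Fin N)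
    (i : Fin r) : MonoidAlgebra ℂ (Equiv.Perm (Fin N)) :=
  ((numStandard (lam i) : ℂ) / ((lam i).card.factorial : ℂ)) •
    ∑ σ : rowStab T i, ∑ τ : colStab T i,
      MonoidAlgebra.single ((τ : Equiv.Perm (Fin N)) * (σ : Equiv.Perm (Fin N)))
        (((Equiv.Perm.sign (τ : Equiv.Perm (Fin N)) : ℤˣ) : ℤ) : ℂ)

/-- `e_T = e_{T^1} ⋯ e_{T^r}`. -/
noncomputable def symmetrizer {r N : ℕ} {lam : Fin r → YoungDiagram} (T : Cell lam → Fin N) :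
    MonoidAlgebra ℂ (Equiv.Perm (Fin N)) :=
  (List.ofFn fun i => youngSymmetrizer T i).prod

/-- The higher Specht polynomial `F_T^S = e_T (x_T^{i(S)})`. -/
noncomputable def higherSpecht {r N : ℕ} {lam : Fin r → YoungDiagram} (T S : Cell lam → Fin N) :
    MvPolynomial (Fin N) ℂ :=
  groupAlgebraAct N (symmetrizer T)
    (∏ c : Cell lam, X (T c) ^ indexTableau (fun d => (S d : ℕ)) c)

/-- The higher Specht polynomial `F_{T^i}^s = e_{T^i} (x_{T^i}^{i(s)})` of the single component
`T^i`, for a filling `s` of its shape. -/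
noncomputable def componentSpecht {r N : ℕ} {lam : Fin r → YoungDiagram} (T : Cell lam → Fin N)
    (i : Fin r) (s : Cell (fun _ : Fin 1 => lam i) → ℕ) : MvPolynomial (Fin N) ℂ :=
  groupAlgebraAct N (youngSymmetrizer T i)
    (∏ c : {c : ℕ × ℕ // c ∈ (lam i).cells}, X (T ⟨i, c⟩) ^ indexTableau s ⟨0, c⟩)

/-- `F_T = F_{T^1}^{S_0^1} ⊗ ⋯ ⊗ F_{T^r}^{S_0^r}`, where `S_0^i` is the canonical tableau of the
shape of `T^i`. The tensor product of polynomials in the separate blocks of variables is their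
product. -/
noncomputable def spechtPoly {r N : ℕ} {lam : Fin r → YoungDiagram} (T : Cell lam → Fin N) :
    MvPolynomial (Fin N) ℂ :=
  ∏ i, componentSpecht T i (canonicalTableau (lam i))

/-- The subgroup `S_{n_1} × ⋯ × S_{n_r}` of `S_n`: permutations preserving each block. -/
def youngSubgroup {r : ℕ} (n : Fin r → ℕ) : Subgroup (Equiv.Perm (Fin (∑ i, n i))) :=
  ⨅ i, MulAction.stabilizer (Equiv.Perm (Fin (∑ i, n i))) (block n i)

/-- `O_Y`: the polynomials invariant under `S_{n_1} × ⋯ × S_{n_r}`. -/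
noncomputable def invariantRing {r : ℕ} (n : Fin r → ℕ) :
    Subalgebra ℂ (MvPolynomial (Fin (∑ i, n i)) ℂ) :=
  ⨅ σ : youngSubgroup n,
    AlgHom.equalizer (rename (σ : Equiv.Perm (Fin (∑ i, n i)))) (AlgHom.id ℂ _)

open Classical in
/-- `Δ = ∏_i Δ_i`, where `Δ_i` is the product of `x_j - x_k` over `j < k` in the `i`-th block. -/
noncomputable def disc {r : ℕ} (n : Fin r → ℕ) : MvPolynomial (Fin (∑ i, n i)) ℂ :=
  ∏ i : Fin r, ∏ p : Fin (∑ i, n i) × Fin (∑ i, n i) with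
    p.1 ∈ block n i ∧ p.2 ∈ block n i ∧ p.1 < p.2, (X p.1 - X p.2)

/-- `O_U = ℂ[x_1, …, x_n, Δ⁻¹]`. -/
abbrev OU {r : ℕ} (n : Fin r → ℕ) : Type := Localization.Away (disc n)

/-- The inclusion of the polynomial ring in `O_U`. -/
noncomputable def toOU {r : ℕ} (n : Fin r → ℕ) : MvPolynomial (Fin (∑ i, n i)) ℂ →ₐ[ℂ] OU n :=
  IsScalarTower.toAlgHom ℂ _ _

theorem isUnit_sub {r : ℕ} (n : Fin r → ℕ) {i : Fin r} {j k : Fin (∑ i, n i)}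
    (hj : j ∈ block n i) (hk : k ∈ block n i) (hjk : j ≠ k) : IsUnit (toOU n (X j - X k)) := by
  classical
  have key : ∀ {j k : Fin (∑ i, n i)}, j ∈ block n i → k ∈ block n i → j < k →
      IsUnit (toOU n (X j - X k)) := by
    intro j k hj hk hlt
    have hu : IsUnit (toOU n (disc n)) := IsLocalization.Away.algebraMap_isUnit (disc n)
    refine isUnit_of_dvd_unit (map_dvd _ ?_) hu
    refine Dvd.dvd.trans ?_ (Finset.dvd_prod_of_mem _ (Finset.mem_univ i))
    exact Finset.dvd_prod_of_mem (fun p : Fin (∑ i, n i) × Fin (∑ i, n i) =>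
      (X p.1 - X p.2 : MvPolynomial (Fin (∑ i, n i)) ℂ)) (a := (j, k)) (by simp [hj, hk, hlt])
  rcases lt_or_gt_of_ne hjk with h | h
  · exact key hj hk h
  · have := (key hk hj h).neg
    rwa [← map_neg, neg_sub] at this

theorem mem_block_of_mem {r : ℕ} {n : Fin r → ℕ} {σ : Equiv.Perm (Fin (∑ i, n i))}
    (hσ : σ ∈ youngSubgroup n) {i : Fin r} {k : Fin (∑ i, n i)} (hk : k ∈ block n i) :
    σ k ∈ block n i := by
  have h := MulAction.mem_stabilizer_iff.1 ((Subgroup.mem_iInf.1 hσ) i)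
  rw [← h]
  exact Set.smul_mem_smul_set hk

theorem isUnit_rename_disc {r : ℕ} (n : Fin r → ℕ) (σ : youngSubgroup n) :
    IsUnit (toOU n (rename (σ : Equiv.Perm (Fin (∑ i, n i))) (disc n))) := by
  classical
  have h : toOU n (rename (σ : Equiv.Perm (Fin (∑ i, n i))) (disc n)) =
      ∏ i : Fin r, ∏ p : Fin (∑ i, n i) × Fin (∑ i, n i) with
        p.1 ∈ block n i ∧ p.2 ∈ block n i ∧ p.1 < p.2,
        toOU n (rename (σ : Equiv.Perm (Fin (∑ i, n i))) (X p.1 - X p.2)) := by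
    conv_lhs => arg 2; arg 2; rw [disc]
    simp only [map_prod]
  rw [h, IsUnit.prod_univ_iff]
  intro i
  rw [IsUnit.prod_iff]
  rintro ⟨j, k⟩ hp
  simp only [Finset.mem_filter, Finset.mem_univ, true_and] at hp
  rw [map_sub, rename_X, rename_X]
  exact isUnit_sub n (mem_block_of_mem σ.2 hp.1) (mem_block_of_mem σ.2 hp.2.1)
    (fun h => hp.2.2.ne (σ.1.injective h))

/-- The action of `S_{n_1} × ⋯ × S_{n_r}` on `O_U` that extends the one on polynomials. -/
noncomputable def actOU {r : ℕ} (n : Fin r → ℕ) (σ : youngSubgroup n) : OU n →+* OU n :=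
  IsLocalization.Away.lift (disc n)
    (g := (toOU n).toRingHom.comp
      (rename (σ : Equiv.Perm (Fin (∑ i, n i))) : _ →ₐ[ℂ] MvPolynomial _ ℂ).toRingHom)
    (isUnit_rename_disc n σ)

theorem actOU_toOU {r : ℕ} (n : Fin r → ℕ) (σ : youngSubgroup n)
    (f : MvPolynomial (Fin (∑ i, n i)) ℂ) :
    actOU n σ (toOU n f) = toOU n (rename (σ : Equiv.Perm (Fin (∑ i, n i))) f) :=
  IsLocalization.Away.lift_eq (disc n) (isUnit_rename_disc n σ) f

/-- `δ = ∂/∂y_j` on `O_U`, for coordinates `y`: the derivation with `∂y_k/∂y_j = δ_{jk}`. If the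
`y_k` are free generators of `O_Y`, there is exactly one, as the Jacobian determinant of `y` is a
nonzero constant multiple of `Δ`, a unit of `O_U`. -/
def IsPartial {r : ℕ} (n : Fin r → ℕ)
    (y : Fin (∑ i, n i) → MvPolynomial (Fin (∑ i, n i)) ℂ) (j : Fin (∑ i, n i))
    (δ : Derivation ℂ (OU n) (OU n)) : Prop :=
  ∀ k, δ (toOU n (y k)) = if k = j then 1 else 0

/-- `D_V = ℂ⟨y_1, …, y_n, ∂/∂y_1, …, ∂/∂y_n, Δ⁻²⟩`, as the algebra of operators on `O_U` generated
by these operators. (`D_V` acts faithfully on `O_U`.) -/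
noncomputable def DV {r : ℕ} (n : Fin r → ℕ)
    (y : Fin (∑ i, n i) → MvPolynomial (Fin (∑ i, n i)) ℂ) :
    Subalgebra ℂ (Module.End ℂ (OU n)) :=
  Algebra.adjoin ℂ
    (Set.range (fun j => LinearMap.mulLeft ℂ (toOU n (y j))) ∪
      {E | ∃ (j : Fin (∑ i, n i)) (δ : Derivation ℂ (OU n) (OU n)),
        IsPartial n y j δ ∧ E = (δ : OU n →ₗ[ℂ] OU n)} ∪
      {LinearMap.mulLeft ℂ (IsLocalization.Away.invSelf (S := OU n) (disc n) ^ 2)})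

/-- For a natural tableau, `C(T)` is a subgroup of `S_{n_1} × ⋯ × S_{n_r}`. -/
theorem colStabilizer_le {r : ℕ} {n : Fin r → ℕ} {lam : Fin r → YoungDiagram}
    {T : Cell lam → Fin (∑ i, n i)} (hT : IsNatural n T) :
    colStabilizer T ≤ youngSubgroup n := by
  refine iSup_le fun i σ hσ => Subgroup.mem_iInf.2 fun l => ?_
  rw [MulAction.mem_stabilizer_iff]
  have hfix : ∀ k, k ∉ entries T i → σ k = k := fun k hk =>
    (mem_fixingSubgroup_iff _).1 hσ.1 k hk
  have hcol : ∀ c : Cell lam, c.1 = i → ∃ d : Cell lam, d.1 = i ∧ T d = σ (T c) := by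
    intro c hc
    have h := MulAction.mem_stabilizer_iff.1 ((Subgroup.mem_iInf.1 hσ.2) c.col)
    have hm : σ (T c) ∈ σ • {k | ∃ d : Cell lam, d.1 = i ∧ d.col = c.col ∧ T d = k} :=
      Set.smul_mem_smul_set ⟨c, hc, rfl, rfl⟩
    rw [h] at hm
    obtain ⟨d, hd, _, hd'⟩ := hm
    exact ⟨d, hd, hd'⟩
  have hsub : σ • block n l ⊆ block n l := by
    rintro _ ⟨k, hk, rfl⟩
    rw [← hT.natural l] at hk ⊢
    obtain ⟨c, hc, rfl⟩ := hk
    by_cases hcl : c.1 = i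
    · obtain ⟨d, hd, hd'⟩ := hcol c hcl
      exact ⟨d, by rw [hd, ← hcl, hc], hd'⟩
    · refine ⟨c, hc, (hfix _ ?_).symm⟩
      rintro ⟨d, hd, hd'⟩
      exact hcl (hT.standard.bijective.1 hd' ▸ hd)
  exact Set.eq_of_subset_of_ncard_le hsub (by rw [Set.ncard_smul_set]) (Set.toFinite _)

end HigherSpecht

/-!
The group `C(T)` acts on `F_T^S` through the sign, because left multiplication by `σ ∈ C(T^i)`
turns `e_{T^i}` into `sgn(σ) e_{T^i}` and `σ` commutes with the other factors of `e_T`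
(`rename_higherSpecht`). The operators in `D_V` commute with the action of
`S_{n_1} × ⋯ × S_{n_r}` on `O_U` (`actOU_DV`), so `D(F_T^S)` is alternating for `C(T)` as well.

For the generators `y_j` and `Δ⁻²` of `D_V` this is their invariance. For `∂/∂y_j` it follows from
uniqueness: `x_k` is a simple root of `∏_{j ∈ B_i} (t - x_j)`, whose coefficients are invariant
and whose derivative at `x_k` is a unit of `O_U`, so a derivation of `O_U` that vanishes on the
invariants is zero (`derivation_eq_zero`).

Finally, `F_T` is an alternating *unit* of `O_U`. The index tableau of the canonical tableau has
the row numbers as its entries (`indexTableau_canonicalTableau`), so the monomial in `F_{T^i}` is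
fixed by `R(T^i)`, and its antisymmetrization over `C(T^i)` is the determinant of a block diagonal
matrix whose blocks are Vandermonde matrices of the columns
(`componentSpecht_canonicalTableau`, `isUnit_componentSpecht`). The differences that occur divide
`Δ`, and the scalar factor `f^{λ^i} / n_i!` is nonzero as it divides `F_T^S ≠ 0`. Therefore the
quotient `G = D(F_T^S) / F_T` exists, and it is invariant as a quotient of two alternating elements.
-/

namespace HigherSpecht

/-! ### Alternating polynomials -/

theorem groupAlgebraAct_single {N : ℕ} (σ : Equiv.Perm (Fin N)) (a : ℂ)
    (f : MvPolynomial (Fin N) ℂ) :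
    groupAlgebraAct N (MonoidAlgebra.single σ a) f = a • rename σ f := by
  simp [groupAlgebraAct, MonoidAlgebra.lift_single]

variable {r N : ℕ} {lam : Fin r → YoungDiagram} {T : Cell lam → Fin N}

/-- The sign of a permutation as a complex number. -/
noncomputable def csign (σ : Equiv.Perm (Fin N)) : ℂ := (((Equiv.Perm.sign σ : ℤˣ) : ℤ) : ℂ)

theorem csign_mul (σ τ : Equiv.Perm (Fin N)) : csign (σ * τ) = csign σ * csign τ := by
  simp [csign]

theorem csign_mul_self (σ : Equiv.Perm (Fin N)) : csign σ * csign σ = 1 := by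
  rw [← csign_mul, csign, map_mul, Int.units_mul_self]
  simp

/-- Left multiplication by `σ ∈ C(T^i)` permutes the summands `τ` of `e_{T^i}`. -/
theorem single_mul_youngSymmetrizer_self {i : Fin r} {σ : Equiv.Perm (Fin N)}
    (hσ : σ ∈ colStab T i) :
    MonoidAlgebra.single σ (1 : ℂ) * youngSymmetrizer T i = csign σ • youngSymmetrizer T i := by
  classical
  rw [youngSymmetrizer, mul_smul_comm, smul_comm (csign σ), Finset.mul_sum,
    Finset.smul_sum (r := csign σ)]
  congr 1
  refine Finset.sum_congr rfl fun ρ _ => ?_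
  rw [Finset.mul_sum, Finset.smul_sum]
  refine Fintype.sum_equiv (Equiv.mulLeft (⟨σ, hσ⟩ : colStab T i)) _ _ fun τ => ?_
  rw [MonoidAlgebra.single_mul_single, MonoidAlgebra.smul_single]
  have h := csign_mul_self σ
  have h2 := csign_mul σ (τ : Equiv.Perm (Fin N))
  simp only [csign] at h h2 ⊢
  simp only [Equiv.coe_mulLeft, Subgroup.coe_mul, smul_eq_mul, mul_assoc, h2]
  rw [← mul_assoc (Int.cast _), h]

/-- Permutations that move only entries of different components commute. -/
theorem commute_of_ne (hT : Function.Injective T) {i j : Fin r} (hij : i ≠ j)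
    {σ τ : Equiv.Perm (Fin N)} (hσ : σ ∈ fixingSubgroup (Equiv.Perm (Fin N)) (entries T i)ᶜ)
    (hτ : τ ∈ fixingSubgroup (Equiv.Perm (Fin N)) (entries T j)ᶜ) : Commute σ τ := by
  refine Equiv.Perm.Disjoint.commute fun k => ?_
  by_cases hk : k ∈ entries T i
  · right
    refine (mem_fixingSubgroup_iff _).1 hτ k ?_
    obtain ⟨c, rfl, rfl⟩ := hk
    rintro ⟨d, rfl, hd⟩
    exact hij (by rw [hT hd])
  · left
    exact (mem_fixingSubgroup_iff _).1 hσ k hk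

theorem commute_youngSymmetrizer (hT : Function.Injective T) {i j : Fin r} (hij : i ≠ j)
    {σ : Equiv.Perm (Fin N)} (hσ : σ ∈ colStab T i) :
    Commute (MonoidAlgebra.single σ (1 : ℂ)) (youngSymmetrizer T j) := by
  classical
  rw [youngSymmetrizer]
  refine Commute.smul_right (Commute.sum_right _ _ _ fun ρ _ =>
    Commute.sum_right _ _ _ fun τ _ => ?_) _
  have h : Commute σ ((τ : Equiv.Perm (Fin N)) * ρ) :=
    (commute_of_ne hT hij hσ.1 τ.2.1).mul_right (commute_of_ne hT hij hσ.1 ρ.2.1)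
  rw [Commute, SemiconjBy, MonoidAlgebra.single_mul_single, MonoidAlgebra.single_mul_single,
    h.eq, one_mul, mul_one]

/-- A left eigenvector relation for one factor of a product passes to the product if `g` commutes
with the other factors. The factor `a i` may occur repeatedly; only its first occurrence is used. -/
theorem mul_list_prod_eq_smul {ι A : Type*} [Ring A] [Algebra ℂ A] (a : ι → A) (g : A) (s : ℂ)
    (i : ι) (hi : g * a i = s • a i) (hne : ∀ j, i ≠ j → Commute g (a j)) :
    ∀ l : List ι, i ∈ l → g * (l.map a).prod = s • (l.map a).prod
  | [], h => by simp at h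
  | j :: l, h => by
    rw [List.map_cons, List.prod_cons]
    by_cases hij : i = j
    · subst hij
      rw [← mul_assoc, hi, smul_mul_assoc]
    · have hl : i ∈ l := (List.mem_cons.1 h).resolve_left hij
      rw [← mul_assoc, (hne j hij).eq, mul_assoc, mul_list_prod_eq_smul a g s i hi hne l hl,
        mul_smul_comm]

theorem rename_higherSpecht (hT : Function.Injective T) (S : Cell lam → Fin N) {i : Fin r}
    {σ : Equiv.Perm (Fin N)} (hσ : σ ∈ colStab T i) :
    rename σ (higherSpecht T S) = csign σ • higherSpecht T S := by
  have h : MonoidAlgebra.single σ (1 : ℂ) * symmetrizer T = csign σ • symmetrizer T := by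
    rw [symmetrizer, List.ofFn_eq_map]
    exact mul_list_prod_eq_smul _ _ _ i (single_mul_youngSymmetrizer_self hσ)
      (fun j hij => commute_youngSymmetrizer hT hij hσ) _ (List.mem_finRange i)
  rw [higherSpecht, ← one_smul ℂ (rename σ _), ← groupAlgebraAct_single, ← Module.End.mul_apply,
    ← map_mul, h, map_smul, LinearMap.smul_apply]

theorem rename_componentSpecht_self {i : Fin r} (s : Cell (fun _ : Fin 1 => lam i) → ℕ)
    {σ : Equiv.Perm (Fin N)} (hσ : σ ∈ colStab T i) :
    rename σ (componentSpecht T i s) = csign σ • componentSpecht T i s := by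
  rw [componentSpecht, ← one_smul ℂ (rename σ _), ← groupAlgebraAct_single,
    ← Module.End.mul_apply, ← map_mul, single_mul_youngSymmetrizer_self hσ, map_smul,
    LinearMap.smul_apply]

theorem rename_componentSpecht_of_ne (hT : Function.Injective T) {i j : Fin r} (hij : i ≠ j)
    (s : Cell (fun _ : Fin 1 => lam j) → ℕ) {σ : Equiv.Perm (Fin N)} (hσ : σ ∈ colStab T i) :
    rename σ (componentSpecht T j s) = componentSpecht T j s := by
  rw [componentSpecht, ← one_smul ℂ (rename σ _), ← groupAlgebraAct_single,
    ← Module.End.mul_apply, ← map_mul, (commute_youngSymmetrizer hT hij hσ).eq, map_mul,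
    Module.End.mul_apply, groupAlgebraAct_single, one_smul, map_prod]
  congr 1
  refine Finset.prod_congr rfl fun c _ => ?_
  have hfix : σ (T ⟨j, c⟩) = T ⟨j, c⟩ := by
    refine (mem_fixingSubgroup_iff _).1 hσ.1 _ ?_
    rintro ⟨d, rfl, hd⟩
    exact hij (by rw [hT hd])
  rw [map_pow, rename_X, hfix]

theorem rename_spechtPoly (hT : Function.Injective T) {i : Fin r}
    {σ : Equiv.Perm (Fin N)} (hσ : σ ∈ colStab T i) :
    rename σ (spechtPoly T) = csign σ • spechtPoly T := by
  classical
  rw [spechtPoly, map_prod, ← Finset.mul_prod_erase _ _ (Finset.mem_univ i),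
    ← Finset.mul_prod_erase _ (fun i => componentSpecht T i _) (Finset.mem_univ i),
    rename_componentSpecht_self _ hσ, smul_mul_assoc]
  congr 2
  exact Finset.prod_congr rfl fun j hj =>
    rename_componentSpecht_of_ne hT (Finset.ne_of_mem_erase hj).symm _ hσ

/-- The group `C(T)` is generated by the `C(T^i)`, so it suffices to know how these act. -/
theorem rename_eq_csign_smul {f : MvPolynomial (Fin N) ℂ}
    (hf : ∀ i, ∀ σ ∈ colStab T i, rename σ f = csign σ • f) {σ : Equiv.Perm (Fin N)}
    (hσ : σ ∈ colStabilizer T) : rename σ f = csign σ • f := by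
  refine Subgroup.iSup_induction (fun i => colStab T i)
    (C := fun σ => rename σ f = csign σ • f) hσ hf ?_ ?_
  · simp [csign]
  · intro σ τ h1 h2
    have : rename (σ * τ : Equiv.Perm (Fin N)) f = rename σ (rename τ f) := by
      rw [rename_rename, Equiv.Perm.coe_mul]
    rw [this, h2, map_smul, h1, smul_smul, csign_mul, mul_comm]

/-! ### The index tableau of the canonical tableau -/

theorem canonicalTableau_lt_of_row_lt {mu : YoungDiagram} {c d : Cell (fun _ : Fin 1 => mu)}
    (h : c.row < d.row) : canonicalTableau mu c < canonicalTableau mu d := by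
  have hc : c.col < mu.rowLen c.row := YoungDiagram.mem_iff_lt_rowLen.1 c.2.2
  calc canonicalTableau mu c < ∑ a ∈ Finset.range (c.row + 1), mu.rowLen a := by
        rw [Finset.sum_range_succ, canonicalTableau]; omega
    _ ≤ ∑ a ∈ Finset.range d.row, mu.rowLen a :=
        Finset.sum_le_sum_of_subset (Finset.range_mono h)
    _ ≤ canonicalTableau mu d := Nat.le_add_right _ _

theorem cell_ext {mu : YoungDiagram} {c d : Cell (fun _ : Fin 1 => mu)}
    (hr : c.row = d.row) (hc : c.col = d.col) : c = d := by
  obtain ⟨i, ⟨⟨a, b⟩, h⟩⟩ := c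
  obtain ⟨j, ⟨⟨a', b'⟩, h'⟩⟩ := d
  obtain rfl : i = j := Subsingleton.elim _ _
  simp only [Cell.row, Cell.col] at hr hc
  subst hr hc
  rfl

theorem canonicalTableau_injective (mu : YoungDiagram) :
    Function.Injective (canonicalTableau mu) := by
  intro c d h
  have hr : c.row = d.row := by
    rcases lt_trichotomy c.row d.row with h1 | h1 | h1
    · exact absurd h (canonicalTableau_lt_of_row_lt h1).ne
    · exact h1
    · exact absurd h (canonicalTableau_lt_of_row_lt h1).ne'
  refine cell_ext hr ?_
  rw [canonicalTableau, canonicalTableau, hr] at h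
  exact Nat.add_left_cancel h

/-- In the word of the canonical tableau, the successor of a number stands to its left exactly
when it starts a new row; hence the index of a box is its row. -/
theorem indexTableau_canonicalTableau (mu : YoungDiagram) (c : Cell (fun _ : Fin 1 => mu)) :
    indexTableau (canonicalTableau mu) c = c.row := by
  suffices H : ∀ k, ∀ c : Cell (fun _ : Fin 1 => mu), canonicalTableau mu c = k →
      wordIndex (canonicalTableau mu) k = c.row from H _ c rfl
  intro k
  induction k with
  | zero =>
    intro c hc
    by_contra hne
    obtain ⟨i, ⟨⟨a, b⟩, h⟩⟩ := c
    have hpos : 0 < a := by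
      rcases Nat.eq_zero_or_pos a with rfl | h0
      · exact absurd rfl hne
      · exact h0
    have h0 : ((0, 0) : ℕ × ℕ) ∈ mu.cells := mu.up_left_mem (Nat.zero_le _) (Nat.zero_le _) h
    have := canonicalTableau_lt_of_row_lt (mu := mu) (c := ⟨i, ⟨(0, 0), h0⟩⟩)
      (d := ⟨i, ⟨(a, b), h⟩⟩) hpos
    omega
  | succ k ih =>
    intro c hc
    have key : ∀ d : Cell (fun _ : Fin 1 => mu), canonicalTableau mu d = k →
        ((∃ a b : Cell (fun _ : Fin 1 => mu), canonicalTableau mu a = k + 1 ∧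
          canonicalTableau mu b = k ∧ ReadBefore a b) ↔ ReadBefore c d) := by
      intro d hd
      constructor
      · rintro ⟨a, b, ha, hb, hab⟩
        rwa [canonicalTableau_injective mu (ha.trans hc.symm),
          canonicalTableau_injective mu (hb.trans hd.symm)] at hab
      · exact fun h => ⟨c, d, hc, hd, h⟩
    obtain ⟨i, ⟨⟨a, b⟩, h⟩⟩ := c
    simp only [canonicalTableau, Cell.row, Cell.col] at hc
    rw [wordIndex]
    rcases Nat.eq_zero_or_pos b with rfl | hb
    · rcases Nat.eq_zero_or_pos a with rfl | ha
      · simp at hc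
      · obtain ⟨a, rfl⟩ : ∃ a', a = a' + 1 := ⟨a - 1, by omega⟩
        have h1 : (a, 0) ∈ mu.cells := mu.up_left_mem (Nat.le_succ _) le_rfl h
        have hlen : 0 < mu.rowLen a := YoungDiagram.mem_iff_lt_rowLen.1 h1
        have h2 : (a, mu.rowLen a - 1) ∈ mu.cells :=
          YoungDiagram.mem_iff_lt_rowLen.2 (by omega)
        rw [Finset.sum_range_succ] at hc
        have hd : canonicalTableau mu ⟨i, ⟨(a, mu.rowLen a - 1), h2⟩⟩ = k := by
          simp only [canonicalTableau, Cell.row, Cell.col]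
          omega
        rw [if_pos, ih _ hd]
        · rfl
        · refine (key _ hd).2 (Or.inr ⟨rfl, ?_⟩)
          simp only [Cell.row, Cell.col]
          omega
    · have h2 : (a, b - 1) ∈ mu.cells := mu.up_left_mem le_rfl (Nat.sub_le _ _) h
      have hd : canonicalTableau mu ⟨i, ⟨(a, b - 1), h2⟩⟩ = k := by
        simp only [canonicalTableau, Cell.row, Cell.col]
        omega
      rw [if_neg, ih _ hd]
      · rfl
      · rw [key _ hd]
        rintro (h3 | ⟨-, h3⟩)
        · exact absurd h3 (lt_irrefl _)
        · simp only [Cell.row, Cell.col] at h3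
          omega

/-! ### Antisymmetrized monomials as determinants -/

/-- An injective exponent function whose values form an initial segment of `ℕ` enumerates the
index set, so the matrix is a Vandermonde matrix up to a reindexing. -/
theorem isUnit_det_pow {α R : Type*} [Fintype α] [DecidableEq α] [CommRing R] (v : α → R)
    (e : α → ℕ) (he : Function.Injective e) (hlow : ∀ a, ∀ q < e a, ∃ b, e b = q)
    (hv : ∀ a b, a ≠ b → IsUnit (v a - v b)) :
    IsUnit (Matrix.of fun a b => v a ^ e b).det := by
  have hlt : ∀ a, e a < Fintype.card α := by
    intro a
    have hsub : Finset.range (e a + 1) ⊆ Finset.univ.image e := by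
      intro q hq
      rcases (Nat.lt_succ_iff.1 (Finset.mem_range.1 hq)).lt_or_eq with h | rfl
      · obtain ⟨b, rfl⟩ := hlow a q h
        exact Finset.mem_image_of_mem _ (Finset.mem_univ b)
      · exact Finset.mem_image_of_mem _ (Finset.mem_univ a)
    have := Finset.card_le_card hsub
    rwa [Finset.card_range, Finset.card_image_of_injective _ he, Finset.card_univ] at this
  let f : α → Fin (Fintype.card α) := fun a => ⟨e a, hlt a⟩
  have hf : Function.Bijective f := by
    rw [Fintype.bijective_iff_injective_and_card]
    exact ⟨fun a b h => he (congrArg Fin.val h), by simp⟩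
  let ε := Equiv.ofBijective f hf
  have hM : (Matrix.of fun a b => v a ^ e b) =
      (Matrix.vandermonde (fun p => v (ε.symm p))).submatrix ε ε := by
    ext a b
    simp [Matrix.vandermonde_apply, ε, f]
  rw [hM, Matrix.det_submatrix_equiv_self, Matrix.det_vandermonde, IsUnit.prod_univ_iff]
  intro p
  rw [IsUnit.prod_iff]
  intro q hq
  exact hv _ _ fun h => (Finset.mem_Ioi.1 hq).ne' (ε.symm.injective h)

/-- A colour-preserving antisymmetrization of a monomial is the determinant of a matrix that is
block diagonal for the colouring. -/
theorem sum_sign_rename_eq_det {β : Type*} [DecidableEq β] (colour : Fin N → β) (e : Fin N → ℕ)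
    (H : Subgroup (Equiv.Perm (Fin N))) [DecidablePred (· ∈ H)]
    (hH : ∀ σ, σ ∈ H ↔ ∀ k, colour (σ k) = colour k) :
    ∑ τ : H, csign (τ : Equiv.Perm (Fin N)) •
        rename (τ : Equiv.Perm (Fin N)) (∏ k, (X k : MvPolynomial (Fin N) ℂ) ^ e k) =
      (Matrix.of fun k l => if colour k = colour l then
        (X k : MvPolynomial (Fin N) ℂ) ^ e l else 0).det := by
  rw [Matrix.det_apply]
  rw [← Finset.sum_subset (Finset.subset_univ (Finset.univ.filter (· ∈ H)))]
  · refine (Finset.sum_subtype (Finset.univ.filter (· ∈ H)) (by simp)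
      (fun σ : Equiv.Perm (Fin N) => csign σ •
        rename σ (∏ k, (X k : MvPolynomial (Fin N) ℂ) ^ e k))).symm.trans ?_
    refine Finset.sum_congr rfl fun σ hσ => ?_
    have h := (hH σ).1 (Finset.mem_filter.1 hσ).2
    rw [map_prod, csign, Int.cast_smul_eq_zsmul]
    congr 1
    refine Finset.prod_congr rfl fun k _ => ?_
    simp [h k]
  · intro σ _ hσ
    have h : ¬ ∀ k, colour (σ k) = colour k := by
      rw [← hH]
      simpa using hσ
    push Not at h
    obtain ⟨k, hk⟩ := h
    rw [Finset.prod_eq_zero (Finset.mem_univ k), smul_zero]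
    simp [hk]

/-! ### The Specht polynomials of the components -/

/-- The box of a bijective tableau that contains a given number. -/
noncomputable def cellOf (hT : Function.Bijective T) (k : Fin N) : Cell lam :=
  (Equiv.ofBijective T hT).symm k

theorem apply_cellOf (hT : Function.Bijective T) (k : Fin N) : T (cellOf hT k) = k :=
  (Equiv.ofBijective T hT).apply_symm_apply k

theorem cellOf_apply (hT : Function.Bijective T) (c : Cell lam) : cellOf hT (T c) = c :=
  (Equiv.ofBijective T hT).symm_apply_apply c

/-- The colouring of the numbers whose colour classes are the columns of the `i`-th component
and the singletons outside this component. The linear order on colours is of no importance. -/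
noncomputable def columnColour (hT : Function.Bijective T) (i : Fin r) (k : Fin N) :
    ℕ ⊕ₗ Fin N :=
  if (cellOf hT k).1 = i then toLex (Sum.inl (cellOf hT k).col) else toLex (Sum.inr k)

/-- The row of a number in the `i`-th component, and `0` outside this component. -/
noncomputable def rowExponent (hT : Function.Bijective T) (i : Fin r) (k : Fin N) : ℕ :=
  if (cellOf hT k).1 = i then (cellOf hT k).row else 0

theorem columnColour_eq_inl {hT : Function.Bijective T} {i : Fin r} {k : Fin N} {b : ℕ} :
    columnColour hT i k = toLex (Sum.inl b) ↔ (cellOf hT k).1 = i ∧ (cellOf hT k).col = b := by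
  rw [columnColour]
  split_ifs with h <;> simp [h]

theorem columnColour_eq_inr {hT : Function.Bijective T} {i : Fin r} {k l : Fin N} :
    columnColour hT i k = toLex (Sum.inr l) ↔ (cellOf hT k).1 ≠ i ∧ k = l := by
  rw [columnColour]
  split_ifs with h <;> simp [h]

theorem mem_entries_iff (hT : Function.Bijective T) {i : Fin r} {k : Fin N} :
    k ∈ entries T i ↔ (cellOf hT k).1 = i := by
  constructor
  · rintro ⟨c, hc, rfl⟩
    rwa [cellOf_apply]
  · exact fun h => ⟨_, h, apply_cellOf hT k⟩

theorem mem_colStab_iff (hT : Function.Bijective T) {i : Fin r} {σ : Equiv.Perm (Fin N)} :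
    σ ∈ colStab T i ↔ ∀ k, columnColour hT i (σ k) = columnColour hT i k := by
  have hset : ∀ b, {k : Fin N | ∃ c : Cell lam, c.1 = i ∧ c.col = b ∧ T c = k} =
      {k | columnColour hT i k = toLex (Sum.inl b)} := by
    intro b
    ext k
    rw [Set.mem_ofPred_eq, Set.mem_ofPred_eq, columnColour_eq_inl]
    constructor
    · rintro ⟨c, h1, h2, rfl⟩
      rw [cellOf_apply]
      exact ⟨h1, h2⟩
    · exact fun h => ⟨_, h.1, h.2, apply_cellOf hT k⟩
  rw [colStab, Subgroup.mem_inf, Subgroup.mem_iInf]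
  simp only [hset, MulAction.mem_stabilizer_iff]
  constructor
  · rintro ⟨h1, h2⟩ k
    by_cases hk : (cellOf hT k).1 = i
    · have hk' : columnColour hT i k = toLex (Sum.inl (cellOf hT k).col) := by
        rw [columnColour_eq_inl]
        exact ⟨hk, rfl⟩
      have hm := (h2 (cellOf hT k).col).le (Set.smul_mem_smul_set (a := σ) hk')
      exact Eq.trans hm hk'.symm
    · have : σ k = k :=
        (mem_fixingSubgroup_iff _).1 h1 k fun h => hk ((mem_entries_iff hT).1 h)
      rw [this]
  · intro h
    refine ⟨(mem_fixingSubgroup_iff _).2 fun k hk => ?_, fun b => ?_⟩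
    · have hk' : columnColour hT i k = toLex (Sum.inr k) := by
        rw [columnColour_eq_inr]
        exact ⟨fun h => hk ((mem_entries_iff hT).2 h), rfl⟩
      have := h k
      rw [hk', columnColour_eq_inr] at this
      exact this.2
    · ext k
      rw [Set.mem_smul_set_iff_inv_smul_mem, Set.mem_ofPred_eq, Set.mem_ofPred_eq, ← h]
      simp

theorem rowExponent_apply_of_mem_rowStab (hT : Function.Bijective T) {i : Fin r}
    {σ : Equiv.Perm (Fin N)} (hσ : σ ∈ rowStab T i) (k : Fin N) :
    rowExponent hT i (σ k) = rowExponent hT i k := by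
  by_cases hk : (cellOf hT k).1 = i
  · have h := MulAction.mem_stabilizer_iff.1 ((Subgroup.mem_iInf.1 hσ.2) (cellOf hT k).row)
    have hm : σ • k ∈ σ • {l | ∃ d : Cell lam, d.1 = i ∧ d.row = (cellOf hT k).row ∧ T d = l} :=
      Set.smul_mem_smul_set ⟨_, hk, rfl, apply_cellOf hT k⟩
    rw [h] at hm
    obtain ⟨d, hd, hrow, hd'⟩ := hm
    rw [Equiv.Perm.smul_def] at hd'
    rw [← hd', rowExponent, rowExponent, cellOf_apply, if_pos hd, if_pos hk, hrow]
  · have : σ k = k :=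
      (mem_fixingSubgroup_iff _).1 hσ.1 k fun h => hk ((mem_entries_iff hT).1 h)
    rw [this]

theorem prod_cells_eq_prod_rowExponent (hT : Function.Bijective T) (i : Fin r) :
    ∏ c : {c : ℕ × ℕ // c ∈ (lam i).cells}, (X (T ⟨i, c⟩) : MvPolynomial (Fin N) ℂ) ^ c.1.1 =
      ∏ k, X k ^ rowExponent hT i k := by
  rw [← (Equiv.ofBijective T hT).prod_comp, Fintype.prod_sigma,
    Fintype.prod_eq_single i]
  · refine Finset.prod_congr rfl fun c _ => ?_
    rw [Equiv.ofBijective_apply, rowExponent, cellOf_apply, if_pos rfl, Cell.row]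
  · intro j hj
    refine Finset.prod_eq_one fun c _ => ?_
    simp [rowExponent, cellOf_apply, hj]

open Classical in
/-- For the canonical tableau the row symmetrization is trivial, and the column antisymmetrization
is a determinant. -/
theorem componentSpecht_canonicalTableau (hT : Function.Bijective T) (i : Fin r) :
    componentSpecht T i (canonicalTableau (lam i)) =
      (((numStandard (lam i) : ℂ) / ((lam i).card.factorial : ℂ)) * Fintype.card (rowStab T i)) •
        (Matrix.of fun k l => if columnColour hT i k = columnColour hT i l then
          (X k : MvPolynomial (Fin N) ℂ) ^ rowExponent hT i l else 0).det := by
  rw [componentSpecht]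
  simp only [indexTableau_canonicalTableau]
  have hm : ∏ c : {c : ℕ × ℕ // c ∈ (lam i).cells}, (X (T ⟨i, c⟩) : MvPolynomial (Fin N) ℂ) ^
      Cell.row (⟨0, c⟩ : Cell (fun _ : Fin 1 => lam i)) = ∏ k, X k ^ rowExponent hT i k :=
    prod_cells_eq_prod_rowExponent hT i
  have hrow : ∀ σ : rowStab T i, rename (σ : Equiv.Perm (Fin N))
      (∏ k, (X k : MvPolynomial (Fin N) ℂ) ^ rowExponent hT i k) =
        ∏ k, X k ^ rowExponent hT i k := by
    intro σ
    rw [map_prod, ← Equiv.prod_comp (σ : Equiv.Perm (Fin N)) (fun k => X k ^ rowExponent hT i k)]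
    refine Finset.prod_congr rfl fun k _ => ?_
    rw [map_pow, rename_X, rowExponent_apply_of_mem_rowStab hT σ.2]
  rw [hm, youngSymmetrizer, map_smul, LinearMap.smul_apply, mul_smul, map_sum,
    LinearMap.sum_apply, ← sum_sign_rename_eq_det _ _ (colStab T i) (fun σ => mem_colStab_iff hT)]
  congr 1
  have hσ : ∀ σ : rowStab T i, groupAlgebraAct N (∑ τ : colStab T i,
      MonoidAlgebra.single ((τ : Equiv.Perm (Fin N)) * (σ : Equiv.Perm (Fin N)))
        (((Equiv.Perm.sign (τ : Equiv.Perm (Fin N)) : ℤˣ) : ℤ) : ℂ))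
        (∏ k, X k ^ rowExponent hT i k) = ∑ τ : colStab T i, csign (τ : Equiv.Perm (Fin N)) •
        rename (τ : Equiv.Perm (Fin N))
          (∏ k, (X k : MvPolynomial (Fin N) ℂ) ^ rowExponent hT i k) := by
    intro σ
    rw [map_sum, LinearMap.sum_apply]
    refine Finset.sum_congr rfl fun τ _ => ?_
    rw [groupAlgebraAct_single, Equiv.Perm.coe_mul, ← rename_rename, hrow, csign]
  rw [Finset.sum_congr rfl fun σ _ => hσ σ, Finset.sum_const, Finset.card_univ,
    Nat.cast_smul_eq_nsmul]

theorem mem_block_of_isNatural {n : Fin r → ℕ} {T : Cell lam → Fin (∑ i, n i)}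
    (hT : IsNatural n T) (k : Fin (∑ i, n i)) :
    k ∈ block n (cellOf hT.standard.bijective k).1 := by
  rw [← hT.natural, mem_entries_iff hT.standard.bijective]

/-- The blocks of the determinant are the Vandermonde determinants of the columns. The entries of
a column of a natural tableau lie in one block `B_i`, so their differences divide `Δ`. -/
theorem isUnit_componentSpecht {n : Fin r → ℕ} {T : Cell lam → Fin (∑ i, n i)}
    (hT : IsNatural n T) (i : Fin r)
    (hi : (numStandard (lam i) : ℂ) / ((lam i).card.factorial : ℂ) ≠ 0) :
    IsUnit (toOU n (componentSpecht T i (canonicalTableau (lam i)))) := by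
  classical
  have hb := hT.standard.bijective
  rw [componentSpecht_canonicalTableau hb, map_smul, Algebra.smul_def]
  refine IsUnit.mul ((IsUnit.mk0 _ (mul_ne_zero hi ?_)).map _) ?_
  · exact Nat.cast_ne_zero.2 Fintype.card_ne_zero
  rw [AlgHom.map_det, Matrix.BlockTriangular.det (b := columnColour hb i)]
  · rw [IsUnit.prod_iff]
    intro p _
    have hM : Matrix.toSquareBlock ((toOU n).mapMatrix (Matrix.of fun k l =>
        if columnColour hb i k = columnColour hb i l then
          (X k : MvPolynomial (Fin (∑ i, n i)) ℂ) ^ rowExponent hb i l else 0))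
        (columnColour hb i) p = Matrix.of fun k l : {k // columnColour hb i k = p} =>
          toOU n (X k.1) ^ rowExponent hb i l.1 := by
      ext k l
      simp [Matrix.toSquareBlock_def, k.2, l.2]
    rw [hM]
    induction p using Lex.rec with | _ p
    rcases p with b | l
    · have hrow : ∀ k : {k // columnColour hb i k = toLex (Sum.inl b)},
          rowExponent hb i k.1 = (cellOf hb k.1).row := fun k => by
        rw [rowExponent, if_pos (columnColour_eq_inl.1 k.2).1]
      refine isUnit_det_pow _ _ ?_ ?_ ?_
      · intro k l hkl
        obtain ⟨hk1, hk2⟩ := columnColour_eq_inl.1 k.2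
        obtain ⟨hl1, hl2⟩ := columnColour_eq_inl.1 l.2
        simp only [hrow] at hkl
        apply Subtype.ext
        rw [← apply_cellOf hb k.1, ← apply_cellOf hb l.1]
        congr 1
        generalize cellOf hb k.1 = c at *
        generalize cellOf hb l.1 = d at *
        obtain ⟨i, ⟨⟨a, b⟩, h⟩⟩ := c
        obtain ⟨j, ⟨⟨a', b'⟩, h'⟩⟩ := d
        simp only [Cell.row, Cell.col] at hkl hk1 hk2 hl1 hl2
        subst hkl hk1 hk2 hl1 hl2
        rfl
      · intro k q hq
        obtain ⟨hk1, hk2⟩ := columnColour_eq_inl.1 k.2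
        rw [hrow] at hq
        have hmem : (q, b) ∈ (lam i).cells := by
          generalize cellOf hb k.1 = c at hq hk1 hk2
          subst hk1 hk2
          exact (lam _).up_left_mem hq.le le_rfl c.2.2
        refine ⟨⟨T ⟨i, ⟨(q, b), hmem⟩⟩, ?_⟩, ?_⟩
        · rw [columnColour_eq_inl, cellOf_apply]
          exact ⟨rfl, rfl⟩
        · rw [hrow, cellOf_apply, Cell.row]
      · intro k l hkl
        rw [← map_sub]
        refine isUnit_sub n (i := i) ?_ ?_ (fun h => hkl (Subtype.ext h))
        · have := mem_block_of_isNatural hT k.1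
          rwa [(columnColour_eq_inl.1 k.2).1] at this
        · have := mem_block_of_isNatural hT l.1
          rwa [(columnColour_eq_inl.1 l.2).1] at this
    · have hsub : ∀ k k' : {k // columnColour hb i k = toLex (Sum.inr l)}, k = k' := fun k k' =>
        Subtype.ext ((columnColour_eq_inr.1 k.2).2.trans (columnColour_eq_inr.1 k'.2).2.symm)
      refine isUnit_det_pow _ _ (fun k k' _ => hsub k k') ?_ (fun k k' h => absurd (hsub k k') h)
      intro k q hq
      rw [rowExponent, if_neg (columnColour_eq_inr.1 k.2).1] at hq
      exact absurd hq (Nat.not_lt_zero _)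
  · intro k l hkl
    simp [hkl.ne']

theorem isUnit_spechtPoly {n : Fin r → ℕ} {T : Cell lam → Fin (∑ i, n i)}
    (hT : IsNatural n T)
    (h : ∀ i, (numStandard (lam i) : ℂ) / ((lam i).card.factorial : ℂ) ≠ 0) :
    IsUnit (toOU n (spechtPoly T)) := by
  rw [spechtPoly, map_prod, IsUnit.prod_univ_iff]
  exact fun i => isUnit_componentSpecht hT i (h i)

/-- The normalizing factors of the Young symmetrizers divide `F_T^S`, so they do not vanish if
`F_T^S` does not. -/
theorem numStandard_div_ne_zero {T S : Cell lam → Fin N} (h : higherSpecht T S ≠ 0) (i : Fin r) :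
    (numStandard (lam i) : ℂ) / ((lam i).card.factorial : ℂ) ≠ 0 := by
  intro h0
  refine h ?_
  have : youngSymmetrizer T i = 0 := by rw [youngSymmetrizer, h0, zero_smul]
  rw [higherSpecht, symmetrizer, List.prod_eq_zero, map_zero, LinearMap.zero_apply]
  exact (List.mem_ofFn' _ _).2 ⟨i, this⟩

/-! ### Derivations of `O_U` -/

/-- The chain rule for a derivation that kills the coefficients of a polynomial. -/
theorem derivation_eval {R : Type*} [CommRing R] [Algebra ℂ R] (d : Derivation ℂ R R)
    (Q : Polynomial R) (hQ : ∀ m, d (Q.coeff m) = 0) (a : R) :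
    d (Q.eval a) = Q.derivative.eval a * d a := by
  rw [Polynomial.eval_eq_sum_range, map_sum, Polynomial.derivative_eval,
    Polynomial.sum_over_range _ (by simp), Finset.sum_mul]
  refine Finset.sum_congr rfl fun m _ => ?_
  rw [Derivation.leibniz, hQ, Derivation.leibniz_pow]
  simp only [smul_eq_mul, nsmul_eq_mul]
  ring

variable {n : Fin r → ℕ}

theorem mem_invariantRing {f : MvPolynomial (Fin (∑ i, n i)) ℂ} :
    f ∈ invariantRing n ↔ ∀ σ ∈ youngSubgroup n, rename σ f = f := by
  simp [invariantRing, Algebra.mem_iInf, AlgHom.mem_equalizer]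

/-- Every variable is a simple root, in `O_U`, of a monic polynomial with invariant
coefficients; so a derivation that kills the invariants kills the variables. -/
theorem derivation_eq_zero (hcov : ∀ k, ∃ i, k ∈ block n i) (d : Derivation ℂ (OU n) (OU n))
    (hd : ∀ f ∈ invariantRing n, d (toOU n f) = 0) : d = 0 := by
  classical
  have hX : ∀ k, d (toOU n (X k)) = 0 := by
    intro k
    obtain ⟨i, hk⟩ := hcov k
    let B : Finset (Fin (∑ i, n i)) := Finset.univ.filter (· ∈ block n i)
    let P : Polynomial (MvPolynomial (Fin (∑ i, n i)) ℂ) :=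
      ∏ j ∈ B, (Polynomial.X - Polynomial.C (X j))
    have hP : ∀ m, P.coeff m ∈ invariantRing n := by
      intro m
      rw [mem_invariantRing]
      intro σ hσ
      have hmap : P.map ((rename σ : _ →ₐ[ℂ] MvPolynomial (Fin (∑ i, n i)) ℂ) : _ →+* _) = P := by
        simp only [P, Polynomial.map_prod, Polynomial.map_sub, Polynomial.map_X, Polynomial.map_C,
          RingHom.coe_coe, rename_X]
        refine Finset.prod_equiv σ (fun j => ?_) (fun j _ => rfl)
        simp only [B, Finset.mem_filter, Finset.mem_univ, true_and]
        refine ⟨mem_block_of_mem hσ, fun h => ?_⟩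
        have := mem_block_of_mem (inv_mem hσ) h
        simpa using this
      conv_rhs => rw [← hmap]
      rw [Polynomial.coeff_map]
      rfl
    have hkB : k ∈ B := by simpa [B] using hk
    have hQ : P.map ((toOU n : _ →ₐ[ℂ] OU n) : _ →+* OU n) =
        (Polynomial.X - Polynomial.C (toOU n (X k))) *
          ∏ j ∈ B.erase k, (Polynomial.X - Polynomial.C (toOU n (X j))) := by
      rw [Finset.mul_prod_erase B (fun j => Polynomial.X - Polynomial.C (toOU n (X j))) hkB]
      simp [P, Polynomial.map_prod]
    have h := derivation_eval d (P.map ((toOU n : _ →ₐ[ℂ] OU n) : _ →+* OU n))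
      (fun m => by rw [Polynomial.coeff_map]; exact hd _ (hP m)) (toOU n (X k))
    rw [hQ] at h
    simp only [Polynomial.derivative_mul, Polynomial.eval_mul, Polynomial.eval_add,
      Polynomial.eval_sub, Polynomial.eval_X, Polynomial.eval_C, sub_self, zero_mul, add_zero,
      Polynomial.derivative_sub, Polynomial.derivative_X, Polynomial.derivative_C, sub_zero,
      one_mul, map_zero, Polynomial.eval_prod] at h
    have hu : IsUnit (∏ j ∈ B.erase k, (toOU n (X k) - toOU n (X j))) := by
      rw [IsUnit.prod_iff]
      intro j hj
      rw [← map_sub]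
      have hj' : j ∈ block n i := by simpa [B] using Finset.mem_of_mem_erase hj
      exact isUnit_sub n hk hj' (Finset.ne_of_mem_erase hj).symm
    exact (hu.mul_right_eq_zero).1 h.symm
  have hpoly : ∀ f, d (toOU n f) = 0 := by
    intro f
    induction f using MvPolynomial.induction_on with
    | C a =>
      have : toOU n (C a) = algebraMap ℂ (OU n) a := (toOU n).commutes a
      rw [this, Derivation.map_algebraMap]
    | add p q hp hq => rw [map_add, map_add, hp, hq, add_zero]
    | mul_X p k hp => rw [map_mul, Derivation.leibniz, hp, hX, smul_zero, smul_zero, add_zero]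
  ext z
  obtain ⟨⟨f, s⟩, hs⟩ := IsLocalization.surj (Submonoid.powers (disc n)) z
  have hs' : z * toOU n s = toOU n f := hs
  have hu : IsUnit (toOU n s) := IsLocalization.map_units (OU n) s
  have h := congrArg d hs'
  rw [Derivation.leibniz, hpoly, hpoly, smul_zero, zero_add, smul_eq_mul] at h
  exact (hu.mul_right_eq_zero).1 h

theorem actOU_algebraMap (σ : youngSubgroup n) (a : ℂ) :
    actOU n σ (algebraMap ℂ (OU n) a) = algebraMap ℂ (OU n) a := by
  rw [← (toOU n).commutes a, actOU_toOU, AlgHom.commutes]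

theorem actOU_inv_actOU (σ : youngSubgroup n) (z : OU n) : actOU n σ⁻¹ (actOU n σ z) = z := by
  have h : (actOU n σ⁻¹).comp (actOU n σ) = RingHom.id (OU n) := by
    refine IsLocalization.ringHom_ext (Submonoid.powers (disc n)) (RingHom.ext fun f => ?_)
    change actOU n σ⁻¹ (actOU n σ (toOU n f)) = toOU n f
    rw [actOU_toOU, actOU_toOU, rename_rename, ← Equiv.Perm.coe_mul]
    simp
  exact RingHom.congr_fun h z

/-- The action of an element of `S_{n_1} × ⋯ × S_{n_r}` on `O_U` as a `ℂ`-linear map. -/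
noncomputable def actLin (σ : youngSubgroup n) : OU n →ₗ[ℂ] OU n where
  toFun := actOU n σ
  map_add' := map_add _
  map_smul' a z := by
    rw [Algebra.smul_def, Algebra.smul_def, map_mul, actOU_algebraMap, RingHom.id_apply]

/-- The conjugate `σ⁻¹ δ σ` of a derivation of `O_U`. -/
noncomputable def conjDerivation (σ : youngSubgroup n) (δ : Derivation ℂ (OU n) (OU n)) :
    Derivation ℂ (OU n) (OU n) :=
  Derivation.mk' (actLin σ⁻¹ ∘ₗ (δ : OU n →ₗ[ℂ] OU n) ∘ₗ actLin σ) fun a b => by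
    change actOU n σ⁻¹ (δ (actOU n σ (a * b))) =
      a * actOU n σ⁻¹ (δ (actOU n σ b)) + b * actOU n σ⁻¹ (δ (actOU n σ a))
    rw [map_mul, Derivation.leibniz, smul_eq_mul, smul_eq_mul, map_add, map_mul, map_mul,
      actOU_inv_actOU, actOU_inv_actOU]

/-- The conjugate of `∂/∂y_j` by an element of the group agrees with `∂/∂y_j` on the invariant
polynomials, hence everywhere. -/
theorem actOU_isPartial (hcov : ∀ k, ∃ i, k ∈ block n i)
    {y : Fin (∑ i, n i) → MvPolynomial (Fin (∑ i, n i)) ℂ}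
    (hy : Algebra.adjoin ℂ (Set.range y) = invariantRing n) {j : Fin (∑ i, n i)}
    {δ : Derivation ℂ (OU n) (OU n)} (hδ : IsPartial n y j δ) (σ : youngSubgroup n) (z : OU n) :
    actOU n σ (δ z) = δ (actOU n σ z) := by
  have hyinv : ∀ k, rename (σ : Equiv.Perm (Fin (∑ i, n i))) (y k) = y k := fun k =>
    mem_invariantRing.1 (hy ▸ Algebra.subset_adjoin ⟨k, rfl⟩) _ σ.2
  have h0 : conjDerivation σ δ - δ = 0 := by
    refine derivation_eq_zero hcov _ fun f hf => ?_
    rw [← hy] at hf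
    have hconj : ∀ k, conjDerivation σ δ (toOU n (y k)) = δ (toOU n (y k)) := by
      intro k
      change actOU n σ⁻¹ (δ (actOU n σ (toOU n (y k)))) = _
      rw [actOU_toOU, hyinv, hδ k]
      split_ifs <;> simp
    induction hf using Algebra.adjoin_induction with
    | mem x hx =>
      obtain ⟨k, rfl⟩ := hx
      rw [Derivation.sub_apply, hconj, sub_self]
    | algebraMap a => rw [AlgHom.commutes, Derivation.map_algebraMap]
    | add f g _ _ hf hg => rw [map_add, map_add, hf, hg, add_zero]
    | mul f g _ _ hf hg =>
      rw [map_mul, Derivation.leibniz, hf, hg, smul_zero, smul_zero, add_zero]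
  have h1 : actOU n σ⁻¹ (δ (actOU n σ z)) = δ z :=
    Derivation.congr_fun (sub_eq_zero.1 h0) z
  have h2 := actOU_inv_actOU σ⁻¹ (δ (actOU n σ z))
  rw [inv_inv, h1] at h2
  exact h2

/-- Up to a sign, `Δ ^ 2` is the product of `x_j - x_k` over all ordered pairs of distinct numbers
of the same block, which is visibly invariant. -/
theorem rename_disc_sq {σ : Equiv.Perm (Fin (∑ i, n i))} (hσ : σ ∈ youngSubgroup n) :
    rename σ (disc n) ^ 2 = disc n ^ 2 := by
  classical
  rw [disc, map_prod, ← Finset.prod_pow, ← Finset.prod_pow]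
  refine Finset.prod_congr rfl fun i _ => ?_
  let g : Fin (∑ i, n i) × Fin (∑ i, n i) → MvPolynomial (Fin (∑ i, n i)) ℂ :=
    fun p => X p.1 - X p.2
  let L : Finset (Fin (∑ i, n i) × Fin (∑ i, n i)) := Finset.univ.filter fun p =>
    p.1 ∈ block n i ∧ p.2 ∈ block n i ∧ p.1 < p.2
  let F : Finset (Fin (∑ i, n i) × Fin (∑ i, n i)) := Finset.univ.filter fun p =>
    p.1 ∈ block n i ∧ p.2 ∈ block n i ∧ p.1 ≠ p.2
  change rename σ (∏ p ∈ L, g p) ^ 2 = (∏ p ∈ L, g p) ^ 2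
  have hF : ∏ p ∈ F, g p = (-1) ^ L.card * (∏ p ∈ L, g p) ^ 2 := by
    have hL : F.filter (fun p => p.1 < p.2) = L := by
      ext p
      simp only [F, L, Finset.mem_filter, Finset.mem_univ, true_and]
      exact ⟨fun h => ⟨h.1.1, h.1.2.1, h.2⟩, fun h => ⟨⟨h.1, h.2.1, h.2.2.ne⟩, h.2.2⟩⟩
    have hswap : ∏ p ∈ F.filter (fun p => ¬ p.1 < p.2), g p = ∏ p ∈ L, g p.swap := by
      refine (Finset.prod_equiv (Equiv.prodComm _ _) (fun p => ?_) (fun p _ => rfl)).symm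
      simp only [F, L, Finset.mem_filter, Finset.mem_univ, true_and, Equiv.prodComm_apply,
        Prod.fst_swap, Prod.snd_swap, not_lt]
      exact ⟨fun h => ⟨⟨h.2.1, h.1, h.2.2.ne'⟩, h.2.2.le⟩,
        fun h => ⟨h.1.2.1, h.1.1, lt_of_le_of_ne h.2 h.1.2.2.symm⟩⟩
    rw [← Finset.prod_filter_mul_prod_filter_not F (fun p => p.1 < p.2), hL, hswap,
      ← Finset.prod_mul_distrib, ← Finset.prod_const, ← Finset.prod_pow,
      ← Finset.prod_mul_distrib]
    refine Finset.prod_congr rfl fun p _ => ?_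
    simp only [g, Prod.fst_swap, Prod.snd_swap]
    ring
  have hinv : rename σ (∏ p ∈ F, g p) = ∏ p ∈ F, g p := by
    rw [map_prod]
    refine Finset.prod_equiv (Equiv.prodCongr σ σ) (fun p => ?_) (fun p _ => by simp [g])
    have hb : ∀ k, σ k ∈ block n i ↔ k ∈ block n i := fun k =>
      ⟨fun h => by simpa using mem_block_of_mem (inv_mem hσ) h, mem_block_of_mem hσ⟩
    simp [F, hb]
  rw [hF, map_mul, map_pow, map_pow, map_neg, map_one] at hinv
  exact (isUnit_one.neg.pow L.card).mul_left_cancel hinv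

/-- The operators in `D_V` commute with the action of the group. -/
theorem actOU_DV (hcov : ∀ k, ∃ i, k ∈ block n i)
    {y : Fin (∑ i, n i) → MvPolynomial (Fin (∑ i, n i)) ℂ}
    (hy : Algebra.adjoin ℂ (Set.range y) = invariantRing n) (σ : youngSubgroup n)
    {E : Module.End ℂ (OU n)} (hE : E ∈ DV n y) (z : OU n) :
    actOU n σ (E z) = E (actOU n σ z) := by
  rw [DV] at hE
  induction hE using Algebra.adjoin_induction generalizing z with
  | mem E hE =>
    rcases hE with (⟨k, rfl⟩ | ⟨j, δ, hδ, rfl⟩) | rfl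
    · have hyinv : rename (σ : Equiv.Perm (Fin (∑ i, n i))) (y k) = y k :=
        mem_invariantRing.1 (hy ▸ Algebra.subset_adjoin ⟨k, rfl⟩) _ σ.2
      rw [LinearMap.mulLeft_apply, LinearMap.mulLeft_apply, map_mul, actOU_toOU, hyinv]
    · exact actOU_isPartial hcov hy hδ σ z
    · rw [LinearMap.mulLeft_apply, LinearMap.mulLeft_apply, map_mul]
      congr 1
      have hinv : toOU n (disc n) * IsLocalization.Away.invSelf (S := OU n) (disc n) = 1 :=
        IsLocalization.Away.mul_invSelf (disc n)
      have h1 := congrArg (· ^ 2) (congrArg (actOU n σ) hinv)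
      simp only [map_mul, map_one, mul_pow, one_pow] at h1
      rw [actOU_toOU, ← map_pow, rename_disc_sq σ.2, map_pow] at h1
      have h2 := congrArg (· ^ 2) hinv
      simp only [mul_pow, one_pow] at h2
      have hu : IsUnit (toOU n (disc n) ^ 2) := IsUnit.of_mul_eq_one _ h2
      apply hu.mul_left_cancel
      rw [h2, ← h1, map_pow]
  | algebraMap a =>
    change actLin σ (a • z) = a • actLin σ z
    exact map_smul _ _ _
  | add E F _ _ hE hF => rw [LinearMap.add_apply, LinearMap.add_apply, map_add, hE, hF]
  | mul E F _ _ hE hF => rw [Module.End.mul_apply, Module.End.mul_apply, hE, hF]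

end HigherSpecht

theorem proposition3p16 {r : ℕ} (n : Fin r → ℕ)
    (y : Fin (∑ i, n i) → MvPolynomial (Fin (∑ i, n i)) ℂ)
    (hy : Algebra.adjoin ℂ (Set.range y) = HigherSpecht.invariantRing n)
    (lam : Fin r → YoungDiagram) (hlam : ∀ i, (lam i).card = n i)
    (T S : HigherSpecht.Cell lam → Fin (∑ i, n i))
    (hT : HigherSpecht.IsNatural n T) (hS : HigherSpecht.IsStandard S)
    (D : Derivation ℂ (HigherSpecht.OU n) (HigherSpecht.OU n))
    (hD : (D : HigherSpecht.OU n →ₗ[ℂ] HigherSpecht.OU n) ∈ HigherSpecht.DV n y)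
    (hne : D (HigherSpecht.toOU n (HigherSpecht.higherSpecht T S)) ≠ 0) :
    ∃ G : HigherSpecht.OU n,
      (∀ (σ : Equiv.Perm (Fin (∑ i, n i))) (hσ : σ ∈ HigherSpecht.colStabilizer T),
        HigherSpecht.actOU n ⟨σ, HigherSpecht.colStabilizer_le hT hσ⟩ G = G) ∧
      D (HigherSpecht.toOU n (HigherSpecht.higherSpecht T S)) =
        HigherSpecht.toOU n (HigherSpecht.spechtPoly T) * G := by
  have hinj := hT.standard.bijective.1
  have hF : HigherSpecht.higherSpecht T S ≠ 0 := by
    intro h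
    rw [h, map_zero, map_zero] at hne
    exact hne rfl
  have hcov : ∀ k, ∃ i, k ∈ HigherSpecht.block n i := fun k =>
    ⟨_, HigherSpecht.mem_block_of_isNatural hT k⟩
  obtain ⟨G, hG⟩ := (HigherSpecht.isUnit_spechtPoly hT
    (HigherSpecht.numStandard_div_ne_zero hF)).dvd 
    (a := D (HigherSpecht.toOU n (HigherSpecht.higherSpecht T S)))
  refine ⟨G, fun σ hσ => ?_, hG⟩
  have h1 := HigherSpecht.actOU_DV hcov hy ⟨σ, HigherSpecht.colStabilizer_le hT hσ⟩ hD
    (HigherSpecht.toOU n (HigherSpecht.higherSpecht T S))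
  rw [HigherSpecht.actOU_toOU, HigherSpecht.rename_eq_csign_smul
    (fun i τ => HigherSpecht.rename_higherSpecht hinj S) hσ, map_smul, map_smul] at h1
  change HigherSpecht.actOU n _ (D _) = HigherSpecht.csign σ • D _ at h1
  rw [hG, map_mul, HigherSpecht.actOU_toOU, HigherSpecht.rename_eq_csign_smul
    (fun i τ => HigherSpecht.rename_spechtPoly hinj) hσ, map_smul, smul_mul_assoc] at h1
  -- Both sides of `h1` carry the sign of `σ`, which is cancelled by multiplying with it again.
  have h2 := congrArg (HigherSpecht.csign σ • ·) h1
  simp only [smul_smul, HigherSpecht.csign_mul_self, one_smul] at h2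
  exact (HigherSpecht.isUnit_spechtPoly hT
    (HigherSpecht.numStandard_div_ne_zero hF)).mul_left_cancel h2
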